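/- Let $G$ be any group. A splitting of $G$ is a simplicial tree $T$ with a simplicial action of $G$ that inverts no edge and has no global fixed point, such that $G\backslash T$ has exactly one edge; two splittings are isomorphic if there is a $G$-equivariant isomorphism between their trees. A standard almost invariant set arising from a splitting with tree $T$ is a set $X=\{g\in G : e \text{ points away from } gv\}$, where $v$ is a vertex and $e$ a directed edge of $T$ ($e$ points away from a vertex if its initial vertex is closer to that vertex than its terminal vertex). For $A\subseteq G$ write $A^*=G\setminus A$ and $\mathrm{Stab}(A)=\{g\in G : gA=A\}$. For a subgroup $H$ of $G$, a subset of $G$ is $H$-finite if it is contained in finitely many cosets $Hg_i$. The corners of a pair $(A,B)$ of subsets of $G$ are $A\cap B$, $A\cap B^*$, $A^*\cap B$ and $A^*\cap B^*$; a corner of $(A,B)$ is small if it is $\mathrm{Stab}(A)$-finite. Let $\{\sigma_j\}_{j\in J}$ be any collection of pairwise non-isomorphic splittings of $G$. For each $j\in J$ let $X_j$ be a standard almost invariant set arising from $\sigma_j$, and let $$\Sigma=\{gX_j,\ gX_j^* : g\in G,\ j\in J\}.$$ Then: (0) for all $A,B\in\Sigma$, a corner of $(A,B)$ is $\mathrm{Stab}(A)$-finite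 if and only if it is $\mathrm{Stab}(B)$-finite; (1) $\Sigma$ is in good position: for all $A,B\in\Sigma$, if two corners of the pair $(A,B)$ are small, then one of these two is empty; (2) the relation on $\Sigma$ defined by $$A\le B \iff A\cap B^* \text{ is empty or is the only small corner of the pair } (A,B)$$ is a partial order on $\Sigma$. -/

import Mathlib

open scoped Pointwise

universe u w w'

/-- A splitting of a group `G`: a simplicial tree `T` (so `T` is nonempty, without loops or
multiple edges) with an action of `G` by graph automorphisms that inverts no edge and has no
global fixed point, such that the quotient graph `G \ T` has exactly one edge. -/
structure GroupSplitting (G : Type u) [Group G] where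
  /-- the vertices of the tree -/
  V : Type w
  /-- the action on the vertices -/
  [act : MulAction G V]
  /-- the tree -/
  T : SimpleGraph V
  isTree : T.IsTree
  smul_adj : ∀ (g : G) (a b : V), T.Adj a b → T.Adj (g • a) (g • b)
  no_inversion : ∀ (g : G) (a b : V), T.Adj a b → ¬ (g • a = b ∧ g • b = a)
  no_fixed_point : ¬ ∃ a : V, ∀ g : G, g • a = a
  one_edge : ∃ e ∈ T.edgeSet, ∀ f ∈ T.edgeSet, ∃ g : G, Sym2.map (fun a => g • a) e = f

attribute [instance] GroupSplitting.act

namespace GroupSplitting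

section

variable {G : Type u} [Group G]

/-- Two splittings are isomorphic if there is a `G`-equivariant isomorphism of their trees. -/
def Isomorphic (σ : GroupSplitting.{u, w} G) (τ : GroupSplitting.{u, w'} G) : Prop :=
  ∃ φ : σ.T ≃g τ.T, ∀ (g : G) (a : σ.V), φ (g • a) = g • φ a

/-- The directed edge `e` of the tree points away from the vertex `a`: the initial vertex of `e`
is closer to `a` than its terminal vertex, i.e. the simple path from `a` to the terminal vertex
of `e` runs through `e`. -/
def PointsAway (σ : GroupSplitting.{u, w} G) (e : σ.T.Dart) (a : σ.V) : Prop :=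
  σ.T.dist a e.fst < σ.T.dist a e.snd

/-- `X` is a standard almost invariant set arising from the splitting `σ`: for some base vertex
`v` and some directed edge `e`, it is the set of all `g` such that `e` points away from `g v`. -/
def IsStandardSet (σ : GroupSplitting.{u, w} G) (X : Set G) : Prop :=
  ∃ (v : σ.V) (e : σ.T.Dart), X = {g : G | σ.PointsAway e (g • v)}

/-- A subset of `G` is `H`-finite if it is contained in finitely many cosets `H g`. -/
def IsFiniteMod (H : Subgroup G) (S : Set G) : Prop :=
  ∃ F : Set G, F.Finite ∧ S ⊆ (H : Set G) * F

/-- The set of all translates `g X` of the sets of a family and of their complements `g X*`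
(the union over the family of the sets `Σ(X)`). -/
def translates {J : Type*} (X : J → Set G) : Set (Set G) :=
  {A | ∃ (j : J) (g : G), A = g • X j ∨ A = g • (X j)ᶜ}

/-- `A` itself or its complement. -/
def side (A : Set G) : Bool → Set G
  | true => A
  | false => Aᶜ

/-- The four corners `A ∩ B`, `A ∩ B*`, `A* ∩ B`, `A* ∩ B*` of the pair `(A, B)`. -/
def corner (A B : Set G) (p : Bool × Bool) : Set G :=
  side A p.1 ∩ side B p.2

/-- A corner of `(A, B)` is small if it is `Stab(A)`-finite, where `Stab(A)` is the stabilizer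
of `A` under left multiplication. -/
def IsSmallCorner (A B : Set G) (p : Bool × Bool) : Prop :=
  IsFiniteMod (MulAction.stabilizer G A) (corner A B p)

/-- Good position: whenever two corners of a pair are small, one of these two is empty. -/
def InGoodPosition (S : Set (Set G)) : Prop :=
  ∀ A ∈ S, ∀ B ∈ S, ∀ p q : Bool × Bool, p ≠ q →
    IsSmallCorner A B p → IsSmallCorner A B q → corner A B p = ∅ ∨ corner A B q = ∅

/-- `A ≤ B`: the corner `A ∩ B*` is empty, or is the only small corner of `(A, B)`. -/
def AlmostLE (A B : Set G) : Prop :=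
  A ∩ Bᶜ = ∅ ∨ ∀ p : Bool × Bool, IsSmallCorner A B p ↔ p = (true, false)

end

end GroupSplitting

/-!
Fix a standard set `A = {g | g v ∈ halfSpace e}` of a splitting. Translates and complements of `A`
are standard sets of translated and reversed edges with the same base vertex, and two half-spaces
of a tree are nested up to complements; so the standard sets of one splitting are nested. Moreover
`Stab(A)` is the stabilizer of `e`, the set of `x ∈ A` with `x k ∉ A` is `Stab(A)`-finite for every
`k` (`x⁻¹ e` is an edge of the path from `v` to `k v`), and neither `A` nor its complement is
`Stab(A)`-finite, because the tree has no leaves (`isAlmostInvariant_standardSet`). These properties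
alone imply that smallness of a corner does not depend on the stabilizer used, and that almost
inclusion, "`A ∩ B*` is small", is transitive (`IsAlmostInvariant.isFiniteMod_of_subset`). No
finiteness assumption on `G` is needed.

Two small corners of a pair are then opposite, which says that `A` is equivalent to `B` or to `B*`.
Within one tree nestedness makes one of them empty. For two trees the central point is
`isomorphic_of_almostEq`: splittings with equivalent standard sets are isomorphic. The isomorphism
should send `g e` to `g f`, where `e` and `f` are the edges of the two sets. Inclusion of
half-spaces is determined by almost inclusion of standard sets, except between edges whose
standard sets are equivalent, which can be distinct when there are vertices of valence two. Two
arguments treat these exceptions. A translation preserving the class of `A` moves `e` and `f` in the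
same direction (`AlmostEq.halfSpace_ssubset_smul`); in particular the stabilizers of `e` and `f`
agree. If some `r` exchanges the classes of `A` and `A*`, then `r²` fixes `e`, so `r` fixes a
vertex, and `e` and `f` can be chosen to end at vertices fixed by `r`
(`exists_almostEq_fixed_snd`). With these choices `g e ↦ g f` preserves the order of directed edges
(`Matched.halfSpace_ssubset`), hence adjacency, since consecutive edges are those with nothing in
between; so it induces an isomorphism of trees.

The order axioms follow formally: for `A ≤ B` and `B ≤ C` the only obstruction to `A ≤ C` would be
a second small corner of `(A, C)`, which makes all three sets equivalent and, by good position,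
all the relations honest inclusions.
-/

/-! ### Half-spaces of a tree -/

namespace SimpleGraph

variable {V : Type*} {T : SimpleGraph V}

/-- The half-space behind the directed edge `d`: the vertices from which `d` points away. It
contains the initial vertex of `d` and not the terminal one. Inclusion of half-spaces plays the
role of the usual partial order on the directed edges of a tree. -/
def halfSpace (T : SimpleGraph V) (d : T.Dart) : Set V :=
  {p | T.dist p d.fst < T.dist p d.snd}

theorem mem_halfSpace {d : T.Dart} {p : V} :
    p ∈ T.halfSpace d ↔ T.dist p d.fst < T.dist p d.snd := Iff.rfl

theorem fst_mem_halfSpace (d : T.Dart) : d.fst ∈ T.halfSpace d := by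
  simp [mem_halfSpace, dist_eq_one_iff_adj.2 d.adj]

theorem snd_notMem_halfSpace (d : T.Dart) : d.snd ∉ T.halfSpace d := by
  simp [mem_halfSpace]

theorem Connected.exists_adj_dist_lt (hT : T.Connected) {p q : V} (h : p ≠ q) :
    ∃ z, T.Adj p z ∧ T.dist p q = T.dist z q + 1 := by
  obtain ⟨W, hW⟩ := hT.exists_walk_length_eq_dist p q
  cases W with
  | nil => exact absurd rfl h
  | cons hadj W' =>
    rename_i z
    refine ⟨z, hadj, ?_⟩
    have h1 := dist_le W'
    have h2 := hT.dist_triangle (u := p) (v := z) (w := q)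
    rw [dist_eq_one_iff_adj.2 hadj] at h2
    simp only [Walk.length_cons] at hW
    omega

theorem IsTree.eq_of_adj_of_dist_lt (hT : T.IsTree) {p q a b : V} (ha : T.Adj p a)
    (hb : T.Adj p b) (hda : T.dist a q < T.dist p q) (hdb : T.dist b q < T.dist p q) : a = b := by
  have key : ∀ c, T.Adj p c → T.dist c q < T.dist p q →
      ∃ W : T.Walk p q, W.IsPath ∧ W.getVert 1 = c := by
    intro c hc hdc
    obtain ⟨W, hW⟩ := hT.connected.exists_walk_length_eq_dist c q
    have h2 := hT.connected.dist_triangle (u := p) (v := c) (w := q)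
    rw [dist_eq_one_iff_adj.2 hc] at h2
    refine ⟨Walk.cons hc W, Walk.isPath_of_length_eq_dist _ ?_, by simp⟩
    simp only [Walk.length_cons]
    omega
  obtain ⟨W₁, h₁, rfl⟩ := key a ha hda
  obtain ⟨W₂, h₂, rfl⟩ := key b hb hdb
  rw [(hT.existsUnique_path p q).unique h₁ h₂]

namespace IsTree

variable (hT : T.IsTree)
include hT

theorem halfSpace_symm (d : T.Dart) : T.halfSpace d.symm = (T.halfSpace d)ᶜ := by
  ext p
  have := hT.dist_ne_of_adj p d.adj
  simp only [mem_halfSpace, Dart.symm, Set.mem_compl_iff, Prod.fst_swap, Prod.snd_swap]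
  omega

/-- A directed edge is the only way out of its half-space. -/
theorem eq_of_adj_of_mem_halfSpace {d : T.Dart} {p q : V} (hpq : T.Adj p q)
    (hp : p ∈ T.halfSpace d) (hq : q ∉ T.halfSpace d) : p = d.fst ∧ q = d.snd := by
  rw [mem_halfSpace] at hp hq
  have h1 := hT.dist_eq_dist_add_one_of_adj p d.adj
  have h2 := hT.dist_eq_dist_add_one_of_adj q d.adj
  have h3 := hT.dist_eq_dist_add_one_of_adj d.fst hpq
  have h4 := hT.dist_eq_dist_add_one_of_adj d.snd hpq
  rw [dist_comm (u := d.fst), dist_comm (u := d.fst)] at h3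
  rw [dist_comm (u := d.snd), dist_comm (u := d.snd)] at h4
  by_cases hpx : p = d.fst
  · refine ⟨hpx, ?_⟩
    subst hpx
    rw [dist_self] at h1 h3
    exact (hT.connected.dist_eq_zero_iff).1 (by omega)
  · exfalso
    obtain ⟨z, hz, hzd⟩ := hT.connected.exists_adj_dist_lt hpx
    have h5 := hT.connected.dist_triangle (u := z) (v := d.fst) (w := d.snd)
    rw [dist_eq_one_iff_adj.2 d.adj] at h5
    have : z = q := hT.eq_of_adj_of_dist_lt (q := d.snd) hz hpq (by omega) (by omega)
    subst this
    omega

theorem dart_eq_of_mem_halfSpace {d e : T.Dart} (h₁ : e.fst ∈ T.halfSpace d)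
    (h₂ : e.snd ∉ T.halfSpace d) : e = d := by
  obtain ⟨h, h'⟩ := hT.eq_of_adj_of_mem_halfSpace e.adj h₁ h₂
  exact Dart.ext _ _ (Prod.ext h h')

theorem halfSpace_injective : Function.Injective T.halfSpace := fun d _ h =>
  hT.dart_eq_of_mem_halfSpace (h ▸ fst_mem_halfSpace d) (h ▸ snd_notMem_halfSpace d)

/-- Walking inside the half-space of `d` back to its initial vertex never crosses `e`. -/
theorem halfSpace_subset {d e : T.Dart} (h₁ : d.fst ∈ T.halfSpace e)
    (h₂ : e.snd ∉ T.halfSpace d) : T.halfSpace d ⊆ T.halfSpace e := by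
  suffices H : ∀ n p, T.dist p d.fst = n → p ∈ T.halfSpace d → p ∈ T.halfSpace e from
    fun p hp => H _ p rfl hp
  intro n
  induction n with
  | zero =>
    intro p hp _
    rwa [(hT.connected.dist_eq_zero_iff).1 hp]
  | succ n ih =>
    intro p hp hpd
    have hne : p ≠ d.fst := by rintro rfl; simp at hp
    obtain ⟨z, hz, hzd⟩ := hT.connected.exists_adj_dist_lt hne
    have hzd' : z ∈ T.halfSpace d := by
      by_contra h
      exact hne (hT.eq_of_adj_of_mem_halfSpace hz hpd h).1
    have hze := ih z (by omega) hzd'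
    by_contra hpe
    exact h₂ ((hT.eq_of_adj_of_mem_halfSpace hz.symm hze hpe).2 ▸ hpd)

/-- Any two half-spaces are nested, up to complements. -/
theorem halfSpace_nested (d e : T.Dart) :
    T.halfSpace d ⊆ T.halfSpace e ∨ T.halfSpace e ⊆ T.halfSpace d ∨
      T.halfSpace d ⊆ (T.halfSpace e)ᶜ ∨ (T.halfSpace d)ᶜ ⊆ T.halfSpace e := by
  have key : ∀ e : T.Dart, d.fst ∈ T.halfSpace e →
      T.halfSpace d ⊆ T.halfSpace e ∨ (T.halfSpace d)ᶜ ⊆ T.halfSpace e := by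
    intro e h
    by_cases h₂ : e.snd ∈ T.halfSpace d
    · by_cases h₃ : d.snd ∈ T.halfSpace e
      · right
        rw [← hT.halfSpace_symm]
        exact hT.halfSpace_subset h₃ (by rwa [hT.halfSpace_symm, Set.notMem_compl_iff])
      · left
        rw [hT.dart_eq_of_mem_halfSpace h h₃]
    · exact Or.inl (hT.halfSpace_subset h h₂)
  by_cases h : d.fst ∈ T.halfSpace e
  · have := key e h
    tauto
  · have := key e.symm (by rwa [hT.halfSpace_symm])
    rw [hT.halfSpace_symm, Set.compl_subset_compl] at this
    tauto

theorem snd_mem_of_halfSpace_ssubset {d e : T.Dart} (h : T.halfSpace d ⊂ T.halfSpace e) :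
    d.snd ∈ T.halfSpace e := by
  by_contra hd
  rw [hT.dart_eq_of_mem_halfSpace (h.1 (fst_mem_halfSpace d)) hd] at h
  exact h.ne rfl

theorem fst_notMem_of_halfSpace_ssubset {d e : T.Dart} (h : T.halfSpace d ⊂ T.halfSpace e) :
    e.fst ∉ T.halfSpace d := by
  intro hd
  rw [hT.dart_eq_of_mem_halfSpace hd fun h' => snd_notMem_halfSpace e (h.1 h')] at h
  exact h.ne rfl

/-- Consecutive directed edges without backtracking have increasing half-spaces. -/
theorem halfSpace_ssubset_of_adjacent {d e : T.Dart} (h : d.snd = e.fst) (h' : e.snd ≠ d.fst) :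
    T.halfSpace d ⊂ T.halfSpace e := by
  have h₁ : d.fst ∈ T.halfSpace e := by
    by_contra hd
    exact h' (hT.eq_of_adj_of_mem_halfSpace d.adj.symm (h ▸ fst_mem_halfSpace e) hd).2.symm
  have h₂ : e.snd ∉ T.halfSpace d := fun he =>
    h' (hT.eq_of_adj_of_mem_halfSpace e.adj.symm he (h ▸ snd_notMem_halfSpace d)).1
  refine (hT.halfSpace_subset h₁ h₂).ssubset_of_ne fun heq => ?_
  have := hT.halfSpace_injective heq
  rw [this] at h
  exact e.adj.ne h.symm

theorem not_between_of_adjacent {d e c : T.Dart} (h : d.snd = e.fst)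
    (h₁ : T.halfSpace d ⊂ T.halfSpace c) : ¬ T.halfSpace c ⊂ T.halfSpace e := fun h₂ =>
  hT.fst_notMem_of_halfSpace_ssubset h₂ (h ▸ hT.snd_mem_of_halfSpace_ssubset h₁)

/-- If no half-space lies strictly between those of `d` and `e`, then `e` starts where `d` ends. -/
theorem adjacent_of_not_between {d e : T.Dart} (h : T.halfSpace d ⊂ T.halfSpace e)
    (hn : ∀ c : T.Dart, T.halfSpace d ⊂ T.halfSpace c → ¬ T.halfSpace c ⊂ T.halfSpace e) :
    d.snd = e.fst := by
  by_contra hne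
  obtain ⟨z, hz, hzd⟩ := hT.connected.exists_adj_dist_lt hne
  have hy := hT.snd_mem_of_halfSpace_ssubset h
  have hp := hT.fst_notMem_of_halfSpace_ssubset h
  let c : T.Dart := ⟨(d.snd, z), hz⟩
  have hpc : e.fst ∉ T.halfSpace c := by
    simp only [mem_halfSpace, c, dist_comm (u := e.fst)]
    omega
  refine hn c (hT.halfSpace_ssubset_of_adjacent rfl ?_) ?_
  · rintro (rfl : z = d.fst)
    rw [mem_halfSpace, dist_comm, dist_comm (v := d.snd)] at hp
    omega
  · refine (hT.halfSpace_subset hy fun hq => ?_).ssubset_of_ne fun heq => ?_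
    · have := hT.eq_of_adj_of_mem_halfSpace e.adj.symm hq hpc
      exact snd_notMem_halfSpace e (this.1 ▸ hy)
    · exact hne (congrArg (fun c : T.Dart => c.fst) (hT.halfSpace_injective heq))

theorem dist_fst_lt_dist {d : T.Dart} {p q : V} (hp : p ∈ T.halfSpace d)
    (hq : q ∉ T.halfSpace d) : T.dist p d.fst < T.dist p q := by
  obtain ⟨W, hW⟩ := hT.connected.exists_walk_length_eq_dist p q
  rw [← hW]
  clear hW
  induction W with
  | nil => exact absurd hp hq
  | cons hadj W ih =>
    rename_i a b c
    rw [Walk.length_cons]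
    by_cases hb : b ∈ T.halfSpace d
    · have h1 := ih hb hq
      have h2 := hT.connected.dist_triangle (u := a) (v := b) (w := d.fst)
      rw [dist_eq_one_iff_adj.2 hadj] at h2
      omega
    · rw [(hT.eq_of_adj_of_mem_halfSpace hadj hp hb).1, dist_self]
      omega

/-- Along a strictly increasing sequence of half-spaces the directed edges move off to infinity. -/
theorem le_dist_fst {d : ℕ → T.Dart}
    (hd : ∀ n, T.halfSpace (d n) ⊂ T.halfSpace (d (n + 1))) (n : ℕ) :
    n ≤ T.dist (d 0).fst (d n).fst := by
  induction n with
  | zero => simp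
  | succ n ih =>
    have h0 : T.halfSpace (d 0) ⊆ T.halfSpace (d n) := by
      clear ih
      induction n with
      | zero => rfl
      | succ n ih => exact ih.trans (hd n).1
    have := hT.dist_fst_lt_dist (h0 (fst_mem_halfSpace (d 0)))
      (hT.fst_notMem_of_halfSpace_ssubset (hd n))
    omega

/-- A strictly increasing sequence of half-spaces exhausts the tree. -/
theorem exists_mem_halfSpace {d : ℕ → T.Dart}
    (hd : ∀ n, T.halfSpace (d n) ⊂ T.halfSpace (d (n + 1))) (p : V) :
    ∃ n, p ∈ T.halfSpace (d n) := by
  by_contra! hp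
  have h0 : T.halfSpace (d 0) ⊆ T.halfSpace (d (T.dist (d 0).fst p)) := by
    generalize T.dist (d 0).fst p = n
    induction n with
    | zero => rfl
    | succ n ih => exact ih.trans (hd n).1
  have h1 := hT.dist_fst_lt_dist (h0 (fst_mem_halfSpace (d 0))) (hp _)
  exact absurd h1 (not_lt.2 (hT.le_dist_fst hd _))

/-- An automorphism of a tree that inverts no edge and whose square fixes a vertex `y` fixes the
midpoint of the path from `y` to its image. -/
theorem exists_fixed_of_sq_fixed (φ : T ≃g T) (hφ : ∀ a b, T.Adj a b → ¬ (φ a = b ∧ φ b = a))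
    {y : V} (hy : φ (φ y) = y) : ∃ p, φ p = p := by
  obtain ⟨W, hW⟩ := (hT.existsUnique_path y (φ y)).exists
  have hW' : ((W.map φ.toHom).reverse.copy hy rfl).IsPath := by
    simpa using hW.reverse.map (f := φ.toHom) φ.injective
  have h := (hT.existsUnique_path y (φ y)).unique hW hW'
  have key : ∀ i ≤ W.length, φ (W.getVert (W.length - i)) = W.getVert i := by
    intro i hi
    conv_rhs => rw [h]
    simp [Walk.getVert_copy, Walk.getVert_reverse, Walk.getVert_map]
  rcases Nat.even_or_odd' W.length with ⟨m, hm | hm⟩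
  · refine ⟨W.getVert m, ?_⟩
    have := key m (by omega)
    rwa [show W.length - m = m by omega] at this
  · have h1 := key m (by omega)
    have h2 := key (m + 1) (by omega)
    rw [show W.length - m = m + 1 by omega] at h1
    rw [show W.length - (m + 1) = m by omega] at h2
    exact absurd ⟨h2, h1⟩ (hφ _ _ (W.adj_getVert_succ (by omega)))

end IsTree

end SimpleGraph

/-! ### Subsets finite modulo a subgroup and almost inclusion -/

namespace GroupSplitting

variable {G : Type u} [Group G]

theorem IsFiniteMod.mono {H K : Subgroup G} {S S' : Set G} (h : IsFiniteMod H S) (hH : H ≤ K)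
    (hS : S' ⊆ S) : IsFiniteMod K S' := by
  obtain ⟨F, hF, hSF⟩ := h
  exact ⟨F, hF, hS.trans (hSF.trans (Set.mul_subset_mul_right hH))⟩

theorem IsFiniteMod.union {H : Subgroup G} {S S' : Set G} (h : IsFiniteMod H S)
    (h' : IsFiniteMod H S') : IsFiniteMod H (S ∪ S') := by
  obtain ⟨F, hF, hSF⟩ := h
  obtain ⟨F', hF', hSF'⟩ := h'
  refine ⟨F ∪ F', hF.union hF', ?_⟩
  rw [Set.mul_union]
  exact Set.union_subset_union hSF hSF'

theorem isFiniteMod_empty (H : Subgroup G) : IsFiniteMod H (∅ : Set G) :=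
  ⟨∅, Set.finite_empty, Set.empty_subset _⟩

theorem IsFiniteMod.biUnion {ι : Type*} {H : Subgroup G} {F : Set ι} (hF : F.Finite)
    {S : ι → Set G} (h : ∀ i ∈ F, IsFiniteMod H (S i)) : IsFiniteMod H (⋃ i ∈ F, S i) := by
  induction F, hF using Set.Finite.induction_on with
  | empty => simpa using isFiniteMod_empty H
  | insert _ _ ih =>
    rw [Set.biUnion_insert]
    exact (h _ (Set.mem_insert _ _)).union (ih fun i hi => h i (Set.mem_insert_of_mem _ hi))

theorem IsFiniteMod.smul {A S : Set G} (h : IsFiniteMod (MulAction.stabilizer G A) S) (g : G) :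
    IsFiniteMod (MulAction.stabilizer G (g • A)) (g • S) := by
  obtain ⟨F, hF, hSF⟩ := h
  refine ⟨g • F, hF.smul_set, ?_⟩
  rintro _ ⟨x, hx, rfl⟩
  obtain ⟨a, ha, f, hf, rfl⟩ := hSF hx
  refine ⟨g * a * g⁻¹, ?_, g * f, Set.smul_mem_smul_set hf, by simp [mul_assoc]⟩
  have : a • A = A := ha
  simp [mul_smul, this]

/-- `A` is an almost invariant subset of `G` over its stabilizer: `A` is invariant under right
multiplication by any `k` up to a `Stab(A)`-finite set, and neither `A` nor its complement is
`Stab(A)`-finite. -/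
structure IsAlmostInvariant (A : Set G) : Prop where
  not_isFiniteMod : ¬ IsFiniteMod (MulAction.stabilizer G A) A
  not_isFiniteMod_compl : ¬ IsFiniteMod (MulAction.stabilizer G A) Aᶜ
  exit : ∀ k : G, IsFiniteMod (MulAction.stabilizer G A) {x | x ∈ A ∧ x * k ∉ A}
  enter : ∀ k : G, IsFiniteMod (MulAction.stabilizer G A) {x | x ∉ A ∧ x * k ∈ A}

theorem IsAlmostInvariant.compl {A : Set G} (h : IsAlmostInvariant A) : IsAlmostInvariant Aᶜ := by
  refine ⟨?_, ?_, ?_, ?_⟩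
  · rw [stabilizer_compl]; exact h.2
  · rw [stabilizer_compl, compl_compl]; exact h.1
  · rw [stabilizer_compl]; simpa using h.4
  · rw [stabilizer_compl]; simpa using h.3

/-- Let `P` be invariant under `K` but not `K`-finite, with `P ∩ C` `K`-finite. For each of the
finitely many coset representatives `f` of a `K`-finite subset `Z` of `C` there is one right
translation moving all of `Z ∩ K f` out of `C`; so almost invariance makes `Z` finite modulo the
stabilizer of `C`. -/
theorem IsAlmostInvariant.isFiniteMod_of_subset {C P Z : Set G} (hC : IsAlmostInvariant C)
    {K : Subgroup G} (hK : K ≤ MulAction.stabilizer G P) (hP : ¬ IsFiniteMod K P)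
    (hPC : IsFiniteMod K (P ∩ C)) (hZC : Z ⊆ C) (hZ : IsFiniteMod K Z) :
    IsFiniteMod (MulAction.stabilizer G C) Z := by
  obtain ⟨F', hF', hPF⟩ := hPC
  obtain ⟨F, hF, hZF⟩ := hZ
  obtain ⟨b, hb, hbF⟩ : ∃ b ∈ P, b ∉ (K : Set G) * F' := by
    by_contra! h
    exact hP ⟨F', hF', h⟩
  refine (IsFiniteMod.biUnion hF fun f _ => hC.exit (f⁻¹ * b)).mono le_rfl fun x hx => ?_
  obtain ⟨k, hk, f, hf, rfl⟩ := hZF hx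
  refine Set.mem_biUnion hf ⟨hZC hx, fun hkb => hbF ?_⟩
  have hkP : k * b ∈ P := by
    have : k • P = P := hK hk
    rw [← this]
    exact Set.smul_mem_smul_set hb
  obtain ⟨k', hk', f', hf', he⟩ := hPF ⟨hkP, by simpa [mul_assoc] using hkb⟩
  refine ⟨k⁻¹ * k', K.mul_mem (K.inv_mem hk) hk', f', hf', ?_⟩
  simp only at he
  simp [mul_assoc, he]

theorem IsAlmostInvariant.isFiniteMod_inter_iff {A B : Set G} (hA : IsAlmostInvariant A)
    (hB : IsAlmostInvariant B) :
    IsFiniteMod (MulAction.stabilizer G A) (A ∩ B) ↔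
      IsFiniteMod (MulAction.stabilizer G B) (A ∩ B) :=
  ⟨fun h => hB.isFiniteMod_of_subset le_rfl hA.1 h Set.inter_subset_right h,
    fun h => hA.isFiniteMod_of_subset le_rfl hB.1 (by rwa [Set.inter_comm])
      Set.inter_subset_left h⟩

/-- `A` is almost contained in `B`: the corner `A ∩ B*` is small. -/
def AlmostSubset (A B : Set G) : Prop :=
  IsFiniteMod (MulAction.stabilizer G A) (A ∩ Bᶜ)

theorem almostSubset_of_subset {A B : Set G} (h : A ⊆ B) : AlmostSubset A B := by
  rw [AlmostSubset, ← Set.sdiff_eq, Set.sdiff_eq_empty.2 h]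
  exact isFiniteMod_empty _

theorem AlmostSubset.smul {A B : Set G} (h : AlmostSubset A B) (g : G) :
    AlmostSubset (g • A) (g • B) := by
  have := IsFiniteMod.smul h g
  rwa [Set.smul_set_inter, Set.smul_set_compl] at this

theorem IsAlmostInvariant.almostSubset_iff {A B : Set G} (hA : IsAlmostInvariant A)
    (hB : IsAlmostInvariant B) :
    AlmostSubset A B ↔ IsFiniteMod (MulAction.stabilizer G B) (A ∩ Bᶜ) := by
  rw [AlmostSubset, hA.isFiniteMod_inter_iff hB.compl, stabilizer_compl]

theorem AlmostSubset.compl {A B : Set G} (h : AlmostSubset A B) (hA : IsAlmostInvariant A)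
    (hB : IsAlmostInvariant B) : AlmostSubset Bᶜ Aᶜ := by
  rw [hA.almostSubset_iff hB] at h
  rwa [AlmostSubset, stabilizer_compl, compl_compl, Set.inter_comm]

theorem AlmostSubset.trans {A B C : Set G} (h : AlmostSubset A B) (h' : AlmostSubset B C)
    (hA : IsAlmostInvariant A) (hB : IsAlmostInvariant B) (hC : IsAlmostInvariant C) :
    AlmostSubset A C := by
  rw [hA.almostSubset_iff hC, ← stabilizer_compl]
  refine hC.compl.isFiniteMod_of_subset le_rfl hB.1 h' Set.inter_subset_right ?_
  refine (((hA.almostSubset_iff hB).1 h).union h').mono le_rfl ?_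
  rintro x ⟨hxA, hxC⟩
  by_cases hxB : x ∈ B
  exacts [Or.inr ⟨hxB, hxC⟩, Or.inl ⟨hxA, hxB⟩]

theorem IsAlmostInvariant.not_almostSubset_compl {A : Set G} (hA : IsAlmostInvariant A) :
    ¬ AlmostSubset A Aᶜ := by
  simpa [AlmostSubset] using hA.1

/-- Two sets are equivalent if each is almost contained in the other. -/
def AlmostEq (A B : Set G) : Prop :=
  AlmostSubset A B ∧ AlmostSubset B A

theorem AlmostEq.symm {A B : Set G} (h : AlmostEq A B) : AlmostEq B A :=
  ⟨h.2, h.1⟩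

theorem AlmostEq.smul {A B : Set G} (h : AlmostEq A B) (g : G) : AlmostEq (g • A) (g • B) :=
  ⟨h.1.smul g, h.2.smul g⟩

theorem AlmostEq.compl {A B : Set G} (h : AlmostEq A B) (hA : IsAlmostInvariant A)
    (hB : IsAlmostInvariant B) : AlmostEq Aᶜ Bᶜ :=
  ⟨h.2.compl hB hA, h.1.compl hA hB⟩

theorem AlmostEq.trans {A B C : Set G} (h : AlmostEq A B) (h' : AlmostEq B C)
    (hA : IsAlmostInvariant A) (hB : IsAlmostInvariant B) (hC : IsAlmostInvariant C) :
    AlmostEq A C :=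
  ⟨h.1.trans h'.1 hA hB hC, h'.2.trans h.2 hC hB hA⟩

end GroupSplitting

/-! ### Directed edges of a splitting and the sets they cut out of the group -/

namespace GroupSplitting

variable {G : Type u} [Group G]

section

variable (σ : GroupSplitting.{u, w} G)

/-- The action of a group element on the tree of a splitting. -/
def smulIso (g : G) : σ.T ≃g σ.T where
  toEquiv := MulAction.toPerm g
  map_rel_iff' := ⟨fun h => by simpa using σ.smul_adj g⁻¹ _ _ h, σ.smul_adj g _ _⟩

@[simp]
theorem smulIso_apply (g : G) (a : σ.V) : σ.smulIso g a = g • a := rfl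

instance : MulAction G σ.T.Dart where
  smul g d := ⟨(g • d.fst, g • d.snd), σ.smul_adj g _ _ d.adj⟩
  one_smul d := by
    apply SimpleGraph.Dart.ext
    exact Prod.ext (one_smul G d.fst) (one_smul G d.snd)
  mul_smul g h d := by
    apply SimpleGraph.Dart.ext
    exact Prod.ext (mul_smul g h d.fst) (mul_smul g h d.snd)

variable {σ}

@[simp] theorem smul_fst (g : G) (d : σ.T.Dart) : (g • d).fst = g • d.fst := rfl

@[simp] theorem smul_snd (g : G) (d : σ.T.Dart) : (g • d).snd = g • d.snd := rfl

@[simp] theorem smul_symm (g : G) (d : σ.T.Dart) : (g • d).symm = g • d.symm := rfl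

@[simp] theorem symm_fst (d : σ.T.Dart) : d.symm.fst = d.snd := rfl

@[simp] theorem symm_snd (d : σ.T.Dart) : d.symm.snd = d.fst := rfl

theorem dart_ext {d d' : σ.T.Dart} (h : d.fst = d'.fst) (h' : d.snd = d'.snd) : d = d' :=
  SimpleGraph.Dart.ext _ _ (Prod.ext h h')

theorem smul_ne_symm (g : G) (d : σ.T.Dart) : g • d ≠ d.symm := fun h =>
  σ.no_inversion g d.fst d.snd d.adj
    ⟨congrArg (fun c : σ.T.Dart => c.fst) h, congrArg (fun c : σ.T.Dart => c.snd) h⟩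

theorem exists_smul_dart_eq (d c : σ.T.Dart) : ∃ g : G, g • d = c ∨ g • d = c.symm := by
  obtain ⟨e, -, he⟩ := σ.one_edge
  obtain ⟨g, hg⟩ := he d.edge d.edge_mem
  obtain ⟨h, hh⟩ := he c.edge c.edge_mem
  refine ⟨h * g⁻¹, ?_⟩
  have h₁ : Sym2.map (fun a => (h * g⁻¹) • a) d.edge = c.edge := by
    rw [← hg, ← hh, Sym2.map_map]
    congr 1
    funext a
    simp [mul_smul]
  have h₂ : s((h * g⁻¹) • d.fst, (h * g⁻¹) • d.snd) = s(c.fst, c.snd) := h₁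
  rcases Sym2.eq_iff.1 h₂ with ⟨h₃, h₄⟩ | ⟨h₃, h₄⟩
  exacts [Or.inl (dart_ext h₃ h₄), Or.inr (dart_ext h₃ h₄)]

theorem dist_smul (g : G) (a b : σ.V) : σ.T.dist (g • a) (g • b) = σ.T.dist a b := by
  have key : ∀ (g : G) (a b : σ.V), σ.T.dist (g • a) (g • b) ≤ σ.T.dist a b := by
    intro g a b
    obtain ⟨W, hW⟩ := σ.isTree.connected.exists_walk_length_eq_dist a b
    rw [← hW, ← SimpleGraph.Walk.length_map (σ.smulIso g).toHom W]
    exact SimpleGraph.dist_le (W.map (σ.smulIso g).toHom)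
  refine (key g a b).antisymm ?_
  simpa using key g⁻¹ (g • a) (g • b)

theorem smul_mem_halfSpace {g : G} {d : σ.T.Dart} {p : σ.V} :
    g • p ∈ σ.T.halfSpace (g • d) ↔ p ∈ σ.T.halfSpace d := by
  simp [SimpleGraph.mem_halfSpace, dist_smul]

theorem halfSpace_smul (g : G) (d : σ.T.Dart) :
    σ.T.halfSpace (g • d) = g • σ.T.halfSpace d := by
  ext p
  rw [Set.mem_smul_set_iff_inv_smul_mem, ← smul_mem_halfSpace (g := g) (p := g⁻¹ • p),
    smul_inv_smul]

theorem halfSpace_smul_subset {g : G} {d e : σ.T.Dart} :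
    σ.T.halfSpace (g • d) ⊆ σ.T.halfSpace (g • e) ↔ σ.T.halfSpace d ⊆ σ.T.halfSpace e := by
  rw [halfSpace_smul, halfSpace_smul, Set.smul_set_subset_smul_set_iff]

theorem halfSpace_smul_ssubset {g : G} {d e : σ.T.Dart} :
    σ.T.halfSpace (g • d) ⊂ σ.T.halfSpace (g • e) ↔ σ.T.halfSpace d ⊂ σ.T.halfSpace e := by
  rw [ssubset_iff_subset_not_subset, ssubset_iff_subset_not_subset, halfSpace_smul_subset,
    halfSpace_smul_subset]

theorem halfSpace_symm_ssubset {d e : σ.T.Dart} :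
    σ.T.halfSpace d.symm ⊂ σ.T.halfSpace e.symm ↔ σ.T.halfSpace e ⊂ σ.T.halfSpace d := by
  rw [σ.isTree.halfSpace_symm, σ.isTree.halfSpace_symm, ssubset_iff_subset_not_subset,
    ssubset_iff_subset_not_subset, Set.compl_subset_compl, Set.compl_subset_compl]

theorem eq_of_halfSpace_eq {d e : σ.T.Dart} (h : σ.T.halfSpace d = σ.T.halfSpace e) : d = e :=
  σ.isTree.halfSpace_injective h

/-- The tree has no leaves: if `x` had a single neighbour `y`, then every edge at `y` would
end in a leaf, the tree would be a star with centre `y`, and `y` would be a global fixed point. -/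
theorem exists_adj_ne (d : σ.T.Dart) : ∃ z, σ.T.Adj d.fst z ∧ z ≠ d.snd := by
  by_contra! hleaf
  have hne : ∀ g : G, g • d.fst ≠ d.snd := by
    intro g hg
    refine σ.no_inversion g d.fst d.snd d.adj ⟨hg, ?_⟩
    have h := σ.smul_adj g⁻¹ _ _ d.adj.symm
    rw [← hg, inv_smul_smul] at h
    rw [← hleaf _ h, smul_inv_smul]
  have hstar : ∀ z, σ.T.Adj d.snd z → ∀ z', σ.T.Adj z z' → z' = d.snd := by
    intro z hz z' hz'
    obtain ⟨g, hg | hg⟩ := exists_smul_dart_eq d (⟨(d.snd, z), hz⟩ : σ.T.Dart)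
    · exact absurd (congrArg (fun c : σ.T.Dart => c.fst) hg) (hne g)
    · have h₁ : g • d.fst = z := congrArg (fun c : σ.T.Dart => c.fst) hg
      have h₂ : g • d.snd = d.snd := congrArg (fun c : σ.T.Dart => c.snd) hg
      have h := σ.smul_adj g⁻¹ _ _ hz'
      rw [← h₁, inv_smul_smul] at h
      rw [← h₂, ← hleaf _ h, smul_inv_smul]
  have hall : ∀ p, p = d.snd ∨ σ.T.Adj d.snd p := by
    suffices H : ∀ {p q : σ.V} (_ : σ.T.Walk p q), q = d.snd → p = d.snd ∨ σ.T.Adj d.snd p from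
      fun p => H (σ.isTree.connected p d.snd).some rfl
    intro p q W hq
    induction W with
    | nil => exact Or.inl hq
    | cons hadj W ih =>
      rcases ih hq with h | h
      · exact Or.inr (h ▸ hadj.symm)
      · exact Or.inl (hstar _ h _ hadj.symm)
  refine σ.no_fixed_point ⟨d.snd, fun g => ?_⟩
  rcases hall (g • d.snd) with h | h
  · exact h
  · obtain ⟨k, hk | hk⟩ := exists_smul_dart_eq d (⟨(d.snd, g • d.snd), h⟩ : σ.T.Dart)
    · exact absurd (congrArg (fun c : σ.T.Dart => c.fst) hk) (hne k)
    · have h₁ : k • d.fst = g • d.snd := congrArg (fun c : σ.T.Dart => c.fst) hk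
      exact absurd (by rw [mul_smul, h₁, inv_smul_smul]) (hne (g⁻¹ * k))

theorem exists_halfSpace_ssubset (d : σ.T.Dart) :
    ∃ c : σ.T.Dart, c.snd = d.fst ∧ σ.T.halfSpace c ⊂ σ.T.halfSpace d := by
  obtain ⟨z, hz, hne⟩ := exists_adj_ne d
  exact ⟨⟨(z, d.fst), hz.symm⟩, rfl, σ.isTree.halfSpace_ssubset_of_adjacent rfl hne.symm⟩

theorem exists_smul_eq_fst_or_snd (v : σ.V) (d : σ.T.Dart) :
    ∃ g : G, g • v = d.fst ∨ g • v = d.snd := by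
  have hne : ∃ p, v ≠ p := by
    by_contra! h
    exact d.adj.ne ((h d.fst).symm.trans (h d.snd))
  obtain ⟨p, hp⟩ := hne
  obtain ⟨z, hz, -⟩ := σ.isTree.connected.exists_adj_dist_lt hp
  obtain ⟨g, hg | hg⟩ := exists_smul_dart_eq (⟨(v, z), hz⟩ : σ.T.Dart) d
  · exact ⟨g, Or.inl (congrArg (fun c : σ.T.Dart => c.fst) hg)⟩
  · exact ⟨g, Or.inr (congrArg (fun c : σ.T.Dart => c.fst) hg)⟩

/-- Every half-space contains points of each orbit arbitrarily far from its boundary edge. -/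
theorem exists_smul_mem_halfSpace (v : σ.V) (d : σ.T.Dart) (n : ℕ) :
    ∃ g : G, g • v ∈ σ.T.halfSpace d ∧ n ≤ σ.T.dist (g • v) d.fst := by
  induction n generalizing d with
  | zero =>
    obtain ⟨c, -, hcd⟩ := exists_halfSpace_ssubset d
    obtain ⟨g, hg | hg⟩ := exists_smul_eq_fst_or_snd v c
    · exact ⟨g, hg ▸ hcd.1 (SimpleGraph.fst_mem_halfSpace c), Nat.zero_le _⟩
    · exact ⟨g, hg ▸ σ.isTree.snd_mem_of_halfSpace_ssubset hcd, Nat.zero_le _⟩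
  | succ n ih =>
    obtain ⟨c, hc, hcd⟩ := exists_halfSpace_ssubset d
    obtain ⟨g, hg, hn⟩ := ih c
    refine ⟨g, hcd.1 hg, ?_⟩
    have := σ.isTree.dist_fst_lt_dist hg (SimpleGraph.snd_notMem_halfSpace c)
    rw [hc] at this
    omega

end

variable {σ : GroupSplitting.{u, w} G}

/-- The standard almost invariant set of a base vertex `v` and a directed edge `d`: all `g` with
`g v` in the half-space behind `d`. -/
def standardSet (v : σ.V) (d : σ.T.Dart) : Set G :=
  {g | g • v ∈ σ.T.halfSpace d}

theorem mem_standardSet {v : σ.V} {d : σ.T.Dart} {g : G} :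
    g ∈ standardSet v d ↔ g • v ∈ σ.T.halfSpace d := Iff.rfl

theorem smul_standardSet (g : G) (v : σ.V) (d : σ.T.Dart) :
    g • standardSet v d = standardSet v (g • d) := by
  ext x
  rw [Set.mem_smul_set_iff_inv_smul_mem, mem_standardSet, mem_standardSet,
    ← smul_mem_halfSpace (g := g), smul_eq_mul, mul_smul, smul_inv_smul]

theorem compl_standardSet (v : σ.V) (d : σ.T.Dart) :
    (standardSet v d)ᶜ = standardSet v d.symm := by
  ext x
  rw [mem_standardSet, σ.isTree.halfSpace_symm]
  rfl

theorem standardSet_subset {v : σ.V} {d e : σ.T.Dart} (h : σ.T.halfSpace d ⊆ σ.T.halfSpace e) :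
    standardSet v d ⊆ standardSet v e := fun _ hg => h hg

/-- Distinct translates of an edge have distinct standard sets: if `h d` came strictly after `d` with
no point of the orbit of `v` in between, then neither the terminal vertex of `d` nor the initial
vertex of `h d` would be in this orbit, although it contains an endpoint of every edge. -/
theorem not_halfSpace_ssubset_of_standardSet_eq {v : σ.V} {d : σ.T.Dart} {h : G}
    (heq : standardSet v (h • d) = standardSet v d) :
    ¬ σ.T.halfSpace d ⊂ σ.T.halfSpace (h • d) := by
  intro hlt
  have key : ∀ g : G, g • v ∈ σ.T.halfSpace (h • d) → g • v ∈ σ.T.halfSpace d := fun g hg =>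
    heq.le hg
  obtain ⟨g, hg | hg⟩ := exists_smul_eq_fst_or_snd v d
  · refine σ.isTree.fst_notMem_of_halfSpace_ssubset hlt ?_
    have := key (h * g)
    rw [mul_smul, hg] at this
    exact this (SimpleGraph.fst_mem_halfSpace (h • d))
  · refine SimpleGraph.snd_notMem_halfSpace d ?_
    rw [← hg]
    refine key g ?_
    rw [hg]
    exact σ.isTree.snd_mem_of_halfSpace_ssubset hlt

theorem stabilizer_standardSet (v : σ.V) (d : σ.T.Dart) :
    MulAction.stabilizer G (standardSet v d) = MulAction.stabilizer G d := by
  ext h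
  rw [MulAction.mem_stabilizer_iff, MulAction.mem_stabilizer_iff, smul_standardSet]
  refine ⟨fun heq => ?_, fun heq => by rw [heq]⟩
  by_contra hne
  obtain ⟨g, hg, -⟩ := exists_smul_mem_halfSpace v d 0
  obtain ⟨g', hg', -⟩ := exists_smul_mem_halfSpace v d.symm 0
  rw [σ.isTree.halfSpace_symm] at hg'
  have hg₂ : g • v ∈ σ.T.halfSpace (h • d) := heq.ge hg
  have hg₂' : g' • v ∉ σ.T.halfSpace (h • d) := fun hh => hg' (heq.le hh)
  rcases σ.isTree.halfSpace_nested d (h • d) with hn | hn | hn | hn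
  · exact not_halfSpace_ssubset_of_standardSet_eq heq
      (hn.ssubset_of_ne fun h' => hne (eq_of_halfSpace_eq h').symm)
  · refine not_halfSpace_ssubset_of_standardSet_eq (v := v) (d := d) (h := h⁻¹) ?_ ?_
    · rw [← smul_standardSet, ← heq, smul_standardSet, inv_smul_smul, heq]
    · rw [← halfSpace_smul_ssubset (g := h), smul_inv_smul]
      exact hn.ssubset_of_ne fun h' => hne (eq_of_halfSpace_eq h')
  · exact hn hg hg₂
  · exact hg₂' (hn hg')

theorem not_isFiniteMod_standardSet (v : σ.V) (d : σ.T.Dart) :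
    ¬ IsFiniteMod (MulAction.stabilizer G d) (standardSet v d) := by
  rintro ⟨F, hF, hdF⟩
  obtain ⟨N, hN⟩ := (hF.image fun f => σ.T.dist (f • v) d.fst).bddAbove
  obtain ⟨g, hg, hgN⟩ := exists_smul_mem_halfSpace v d (N + 1)
  obtain ⟨k, hk, f, hf, rfl⟩ := hdF hg
  have hk' : k • d.fst = d.fst :=
    congrArg (fun c : σ.T.Dart => c.fst) (MulAction.mem_stabilizer_iff.1 hk)
  have h₁ : σ.T.dist ((k * f) • v) d.fst = σ.T.dist (f • v) d.fst := by
    rw [← dist_smul k (f • v), hk', mul_smul]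
  have := hN (Set.mem_image_of_mem _ hf)
  simp only at this hgN
  omega

theorem isFiniteMod_separating (v : σ.V) (d : σ.T.Dart) (k : G) :
    IsFiniteMod (MulAction.stabilizer G d)
      {x | x ∈ standardSet v d ∧ x * k ∉ standardSet v d} := by
  -- `x⁻¹ d` is one of the finitely many directed edges on a path from `v` to `k v`
  obtain ⟨W⟩ := σ.isTree.connected v (k • v)
  suffices H : ∀ {p q : σ.V} (W : σ.T.Walk p q), IsFiniteMod (MulAction.stabilizer G d)
      {x : G | x • p ∈ σ.T.halfSpace d ∧ x • q ∉ σ.T.halfSpace d} by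
    simpa [mem_standardSet, mul_smul] using H W
  intro p q W
  induction W with
  | nil => simpa using isFiniteMod_empty _
  | cons hadj W ih =>
    rename_i a b c
    have hstep : IsFiniteMod (MulAction.stabilizer G d)
        {x : G | x • a ∈ σ.T.halfSpace d ∧ x • b ∉ σ.T.halfSpace d} := by
      by_cases hx : ∃ y : G, y • a = d.fst ∧ y • b = d.snd
      · obtain ⟨y, hya, hyb⟩ := hx
        refine ⟨{y}, Set.finite_singleton y, ?_⟩
        rintro x ⟨hxa, hxb⟩
        obtain ⟨h₁, h₂⟩ := σ.isTree.eq_of_adj_of_mem_halfSpace (σ.smul_adj x _ _ hadj) hxa hxb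
        refine ⟨x * y⁻¹, ?_, y, rfl, by simp⟩
        refine dart_ext ?_ ?_
        · rw [smul_fst, ← hya, mul_smul, inv_smul_smul, h₁, hya]
        · rw [smul_snd, ← hyb, mul_smul, inv_smul_smul, h₂, hyb]
      · refine (isFiniteMod_empty _).mono le_rfl ?_
        rintro x ⟨hxa, hxb⟩
        exact hx ⟨x, σ.isTree.eq_of_adj_of_mem_halfSpace (σ.smul_adj x _ _ hadj) hxa hxb⟩
    refine (hstep.union ih).mono le_rfl ?_
    rintro x ⟨hxa, hxc⟩
    by_cases hxb : x • b ∈ σ.T.halfSpace d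
    exacts [Or.inr ⟨hxb, hxc⟩, Or.inl ⟨hxa, hxb⟩]

theorem stabilizer_symm (d : σ.T.Dart) :
    MulAction.stabilizer G d.symm = MulAction.stabilizer G d := by
  ext g
  rw [MulAction.mem_stabilizer_iff, MulAction.mem_stabilizer_iff, ← smul_symm]
  exact (SimpleGraph.Dart.symm_involutive).injective.eq_iff

theorem isAlmostInvariant_standardSet (v : σ.V) (d : σ.T.Dart) :
    IsAlmostInvariant (standardSet v d) := by
  refine ⟨?_, ?_, fun k => ?_, fun k => ?_⟩ <;> rw [stabilizer_standardSet]
  · exact not_isFiniteMod_standardSet v d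
  · rw [compl_standardSet, ← stabilizer_symm]
    exact not_isFiniteMod_standardSet v d.symm
  · exact isFiniteMod_separating v d k
  · have := isFiniteMod_separating v d.symm k
    rw [← compl_standardSet, stabilizer_symm] at this
    simpa using this

/-- Almost nested directed edges are comparable. -/
theorem halfSpace_subset_or_subset {v : σ.V} {d e : σ.T.Dart}
    (h : AlmostSubset (standardSet v d) (standardSet v e)) :
    σ.T.halfSpace d ⊆ σ.T.halfSpace e ∨ σ.T.halfSpace e ⊆ σ.T.halfSpace d := by
  have hd := isAlmostInvariant_standardSet v d
  have he := isAlmostInvariant_standardSet v e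
  rcases σ.isTree.halfSpace_nested d e with hn | hn | hn | hn
  · exact Or.inl hn
  · exact Or.inr hn
  · rw [← σ.isTree.halfSpace_symm] at hn
    have h' := (h.compl hd he)
    refine absurd ?_ hd.not_almostSubset_compl
    refine AlmostSubset.trans ?_ h' hd he.compl hd.compl
    rw [compl_standardSet]
    exact almostSubset_of_subset (standardSet_subset hn)
  · rw [← σ.isTree.halfSpace_symm] at hn
    refine absurd ?_ hd.compl.not_almostSubset_compl
    rw [compl_compl]
    have h' := (h.compl hd he)
    have h₁ : AlmostSubset (standardSet v d)ᶜ (standardSet v e) := by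
      rw [compl_standardSet]
      exact almostSubset_of_subset (standardSet_subset hn)
    have h₂ := h₁.compl hd.compl he
    rw [compl_compl] at h₂
    exact absurd (h₂.trans h he.compl hd he)
      (by simpa using he.compl.not_almostSubset_compl)

end GroupSplitting

/-! ### Equivalent standard sets of two splittings -/

namespace GroupSplitting

variable {G : Type u} [Group G]

section

variable {σ : GroupSplitting.{u, w} G} {τ : GroupSplitting.{u, w'} G}
  {v : σ.V} {v' : τ.V}

theorem AlmostSubset.trans_standardSet {A B : Set G} {d : σ.T.Dart}
    (h : AlmostSubset A (standardSet v d)) (h' : AlmostSubset (standardSet v d) B)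
    (hA : IsAlmostInvariant A := by apply isAlmostInvariant_standardSet)
    (hB : IsAlmostInvariant B := by apply isAlmostInvariant_standardSet) : AlmostSubset A B :=
  h.trans h' hA (isAlmostInvariant_standardSet v d) hB

theorem AlmostEq.trans_standardSet {A B : Set G} {d : σ.T.Dart}
    (h : AlmostEq A (standardSet v d)) (h' : AlmostEq (standardSet v d) B)
    (hA : IsAlmostInvariant A := by apply isAlmostInvariant_standardSet)
    (hB : IsAlmostInvariant B := by apply isAlmostInvariant_standardSet) : AlmostEq A B :=
  h.trans h' hA (isAlmostInvariant_standardSet v d) hB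

theorem AlmostEq.symm_standardSet {d : σ.T.Dart} {e : τ.T.Dart}
    (h : AlmostEq (standardSet v d) (standardSet v' e)) :
    AlmostEq (standardSet v d.symm) (standardSet v' e.symm) := by
  rw [← compl_standardSet, ← compl_standardSet]
  exact h.compl (isAlmostInvariant_standardSet v d) (isAlmostInvariant_standardSet v' e)

theorem AlmostEq.smul_standardSet {d : σ.T.Dart} {e : τ.T.Dart}
    (h : AlmostEq (standardSet v d) (standardSet v' e)) (g : G) :
    AlmostEq (standardSet v (g • d)) (standardSet v' (g • e)) := by
  rw [← GroupSplitting.smul_standardSet, ← GroupSplitting.smul_standardSet]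
  exact h.smul g

theorem not_almostEq_symm (d : σ.T.Dart) :
    ¬ AlmostEq (standardSet v d) (standardSet v d.symm) := fun h => by
  rw [← compl_standardSet] at h
  exact (isAlmostInvariant_standardSet v d).not_almostSubset_compl h.1

/-- Directed edges with equivalent standard sets in the same tree are comparable. -/
theorem AlmostEq.comparable {d e : σ.T.Dart} (h : AlmostEq (standardSet v d) (standardSet v e)) :
    d = e ∨ σ.T.halfSpace d ⊂ σ.T.halfSpace e ∨ σ.T.halfSpace e ⊂ σ.T.halfSpace d := by
  by_cases hde : d = e
  · exact Or.inl hde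
  · rcases halfSpace_subset_or_subset h.1 with h' | h'
    · exact Or.inr (Or.inl (h'.ssubset_of_ne fun h => hde (eq_of_halfSpace_eq h)))
    · exact Or.inr (Or.inr (h'.ssubset_of_ne fun h => hde (eq_of_halfSpace_eq h).symm))

/-- An element translating `e` forward in one tree, without changing the class of its standard
set, translates forward every equivalent directed edge `f` of another tree. Otherwise some `k`
outside the standard set `B` of `f` lies outside all `gⁿ B`, although it lies in `gⁿ A` for all
large `n`. Thus `g⁻ⁿ k ∈ A ∩ B*` for infinitely many `n`, and finiteness modulo the
stabilizer of `e` produces a nontrivial power of `g` fixing `e`. -/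
theorem AlmostEq.halfSpace_ssubset_smul {e : σ.T.Dart} {f : τ.T.Dart}
    (h : AlmostEq (standardSet v e) (standardSet v' f)) {g : G}
    (hg : AlmostEq (standardSet v (g • e)) (standardSet v e))
    (he : σ.T.halfSpace e ⊂ σ.T.halfSpace (g • e)) :
    τ.T.halfSpace f ⊂ τ.T.halfSpace (g • f) := by
  have hgf : AlmostEq (standardSet v' (g • f)) (standardSet v' f) :=
    (h.symm.smul_standardSet g).trans_standardSet (hg.trans_standardSet h)
  have hmono : StrictMono fun n : ℕ => σ.T.halfSpace (g ^ n • e) := by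
    refine strictMono_nat_of_lt_succ fun n => ?_
    simp only [pow_succ, mul_smul]
    exact halfSpace_smul_ssubset.2 he
  by_contra hnot
  have hsub : τ.T.halfSpace (g • f) ⊆ τ.T.halfSpace f := by
    rcases hgf.comparable with h' | h' | h'
    exacts [by rw [h'], h'.1, absurd h' hnot]
  have hpow : ∀ n : ℕ, τ.T.halfSpace (g ^ n • f) ⊆ τ.T.halfSpace f := by
    intro n
    induction n with
    | zero => simp
    | succ n ih =>
      rw [pow_succ, mul_smul]
      exact (halfSpace_smul_subset.2 hsub).trans ih
  obtain ⟨k, hk, -⟩ := exists_smul_mem_halfSpace v' f.symm 0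
  rw [τ.isTree.halfSpace_symm] at hk
  obtain ⟨N, hN⟩ := σ.isTree.exists_mem_halfSpace (d := fun n : ℕ => g ^ n • e)
    (fun n => hmono n.lt_succ_self) (k • v)
  obtain ⟨F, hF, hAB⟩ := h.1
  have hmem : ∀ n : ℕ, ∃ y ∈ F, ∃ s ∈ MulAction.stabilizer G e,
      s * y = (g ^ (N + n))⁻¹ * k := by
    intro n
    have hx : (g ^ (N + n))⁻¹ * k ∈ standardSet v e ∩ (standardSet v' f)ᶜ := by
      constructor
      · rw [mem_standardSet, ← smul_mem_halfSpace (g := g ^ (N + n)), mul_smul, smul_inv_smul]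
        exact hmono.monotone (Nat.le_add_right N n) hN
      · rw [Set.mem_compl_iff, mem_standardSet, ← smul_mem_halfSpace (g := g ^ (N + n)),
          mul_smul, smul_inv_smul]
        exact fun hh => hk (hpow _ hh)
    obtain ⟨s, hs, y, hy, hsy⟩ := hAB hx
    rw [stabilizer_standardSet] at hs
    exact ⟨y, hy, s, hs, hsy⟩
  choose y hyF s hs hsy using hmem
  have : Finite F := hF
  obtain ⟨n, m, hnm, heq⟩ := Finite.exists_ne_map_eq_of_infinite fun n => (⟨y n, hyF n⟩ : F)
  have heq' : y n = y m := congrArg Subtype.val heq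
  have hst : s n * (s m)⁻¹ = (g ^ (N + n))⁻¹ * g ^ (N + m) := by
    have h₁ : s n = (g ^ (N + n))⁻¹ * k * (y n)⁻¹ := by rw [← hsy n, mul_inv_cancel_right]
    have h₂ : s m = (g ^ (N + m))⁻¹ * k * (y n)⁻¹ := by rw [heq', ← hsy m, mul_inv_cancel_right]
    rw [h₁, h₂]
    group
  have hfix : ((g ^ (N + n))⁻¹ * g ^ (N + m)) • e = e := by
    rw [← hst]
    exact (MulAction.stabilizer G e).mul_mem (hs n) ((MulAction.stabilizer G e).inv_mem (hs m))
  rw [mul_smul, inv_smul_eq_iff] at hfix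
  have := hmono.injective (congrArg σ.T.halfSpace hfix)
  omega

/-- Equivalent standard sets have the same edge stabilizer. -/
theorem AlmostEq.smul_eq {e : σ.T.Dart} {f : τ.T.Dart}
    (h : AlmostEq (standardSet v e) (standardSet v' f)) {g : G} (hg : g • e = e) : g • f = f := by
  have key : ∀ g : G, g • e = e → ¬ τ.T.halfSpace f ⊂ τ.T.halfSpace (g • f) := by
    intro g hg hlt
    have hgf : AlmostEq (standardSet v' (g • f)) (standardSet v' f) := by
      refine (h.symm.smul_standardSet g).trans_standardSet ?_
      rwa [hg]
    have := h.symm.halfSpace_ssubset_smul hgf hlt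
    rw [hg] at this
    exact this.ne rfl
  have hgf : AlmostEq (standardSet v' (g • f)) (standardSet v' f) := by
    refine (h.symm.smul_standardSet g).trans_standardSet ?_
    rwa [hg]
  rcases hgf.comparable with h' | h' | h'
  · exact h'
  · refine absurd ?_ (key g⁻¹ (by rw [inv_smul_eq_iff, hg]))
    rwa [← halfSpace_smul_ssubset (g := g), smul_inv_smul]
  · exact absurd h' (key g hg)

theorem AlmostEq.halfSpace_subset_smul {e : σ.T.Dart} {f : τ.T.Dart}
    (h : AlmostEq (standardSet v e) (standardSet v' f)) {g : G}
    (hg : AlmostEq (standardSet v (g • e)) (standardSet v e))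
    (he : σ.T.halfSpace e ⊆ σ.T.halfSpace (g • e)) :
    τ.T.halfSpace f ⊆ τ.T.halfSpace (g • f) := by
  by_cases heq : σ.T.halfSpace e = σ.T.halfSpace (g • e)
  · rw [h.smul_eq (eq_of_halfSpace_eq heq).symm]
  · exact (h.halfSpace_ssubset_smul hg (he.ssubset_of_ne heq)).1

/-- The order of directed edges in one tree is the order of equivalent directed edges in another
one, unless the two standard sets are equivalent to each other. -/
theorem halfSpace_ssubset_or_almostEq {d₁ d₂ : σ.T.Dart} {d₁' d₂' : τ.T.Dart}
    (h₁ : AlmostEq (standardSet v d₁) (standardSet v' d₁'))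
    (h₂ : AlmostEq (standardSet v d₂) (standardSet v' d₂'))
    (h : σ.T.halfSpace d₁ ⊂ σ.T.halfSpace d₂) :
    τ.T.halfSpace d₁' ⊂ τ.T.halfSpace d₂' ∨
      AlmostEq (standardSet v d₁) (standardSet v d₂) := by
  have hA := almostSubset_of_subset (standardSet_subset (v := v) h.1)
  have hB : AlmostSubset (standardSet v' d₁') (standardSet v' d₂') :=
    h₁.2.trans_standardSet (hA.trans_standardSet h₂.1)
  by_cases hlt : τ.T.halfSpace d₁' ⊂ τ.T.halfSpace d₂'
  · exact Or.inl hlt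
  right
  have hsub : τ.T.halfSpace d₂' ⊆ τ.T.halfSpace d₁' := by
    rcases halfSpace_subset_or_subset hB with h' | h'
    · by_contra hn
      exact hlt ⟨h', hn⟩
    · exact h'
  have hB' := almostSubset_of_subset (standardSet_subset (v := v') hsub)
  exact ⟨hA, h₂.1.trans_standardSet (hB'.trans_standardSet h₁.2)⟩

/-! ### Elements exchanging a standard set with its complement -/

theorem smul_smul_eq_of_almostEq_symm {d : σ.T.Dart} {r : G}
    (h : AlmostEq (standardSet v (r • d)) (standardSet v d.symm)) : r • r • d = d := by
  have h' : AlmostEq (standardSet v d) (standardSet v (r • d.symm)) := h.symm.symm_standardSet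
  have hr := (h.smul_standardSet r).trans_standardSet h'.symm
  -- a translation along an axis commuting with `r` cannot have its direction reversed by `r`
  have key : ∀ k : G, k * r = r * k → AlmostEq (standardSet v (k • d)) (standardSet v d) →
      ¬ σ.T.halfSpace d ⊂ σ.T.halfSpace (k • d) := by
    intro k hk hkd hlt
    have := h'.halfSpace_ssubset_smul hkd hlt
    rw [← mul_smul, hk, mul_smul, halfSpace_smul_ssubset, ← smul_symm,
      halfSpace_symm_ssubset] at this
    exact this.asymm hlt
  rw [← mul_smul] at hr ⊢
  rcases hr.comparable with h₁ | h₁ | h₁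
  · exact h₁
  · refine absurd ?_ (key (r * r)⁻¹ (by group) ?_)
    · rwa [← halfSpace_smul_ssubset (g := r * r), smul_inv_smul]
    · have := hr.symm.smul_standardSet (r * r)⁻¹
      rwa [inv_smul_smul] at this
  · exact absurd h₁ (key _ (by group) hr)

theorem exists_almostEq_of_fixed_notMem {d : σ.T.Dart} {r : G} {p : σ.V} (hp : r • p = p)
    (hpd : p ∉ σ.T.halfSpace d) (h : AlmostEq (standardSet v (r • d)) (standardSet v d.symm)) :
    ∃ c : σ.T.Dart, AlmostEq (standardSet v c) (standardSet v d) ∧ c.snd = p := by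
  have hne : p ≠ d.fst := fun h => hpd (h ▸ SimpleGraph.fst_mem_halfSpace d)
  obtain ⟨z, hz, hzd⟩ := σ.isTree.connected.exists_adj_dist_lt hne
  let c : σ.T.Dart := ⟨(z, p), hz.symm⟩
  have hdc : σ.T.halfSpace d ⊆ σ.T.halfSpace c := by
    refine σ.isTree.halfSpace_subset ?_ hpd
    simp only [SimpleGraph.mem_halfSpace, c, SimpleGraph.dist_comm (u := d.fst)]
    omega
  have hsub : AlmostSubset (standardSet v d) (standardSet v c) :=
    almostSubset_of_subset (standardSet_subset hdc)
  have hrz : r • z ≠ z := by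
    intro hrz
    have hrc : r • c = c := dart_ext hrz hp
    have h₁ : AlmostSubset (standardSet v (r • d)) (standardSet v c) := by
      refine almostSubset_of_subset (standardSet_subset ?_)
      rw [← hrc]
      exact halfSpace_smul_subset.2 hdc
    have h₂ : AlmostSubset (standardSet v d.symm) (standardSet v c) := h.2.trans_standardSet h₁
    have h₃ : AlmostSubset (standardSet v c.symm) (standardSet v d.symm) := by
      refine almostSubset_of_subset (standardSet_subset ?_)
      rw [σ.isTree.halfSpace_symm, σ.isTree.halfSpace_symm]
      exact Set.compl_subset_compl.2 hdc
    have h₄ : AlmostSubset (standardSet v c.symm) (standardSet v c) := h₃.trans_standardSet h₂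
    have hc := (isAlmostInvariant_standardSet v c.symm).not_almostSubset_compl
    rw [compl_standardSet, SimpleGraph.Dart.symm_symm] at hc
    exact hc h₄
  have hlt : σ.T.halfSpace c ⊂ σ.T.halfSpace (r • c.symm) :=
    σ.isTree.halfSpace_ssubset_of_adjacent hp.symm hrz
  have hcr : AlmostSubset (standardSet v (r • c.symm)) (standardSet v (r • d.symm)) := by
    refine almostSubset_of_subset (standardSet_subset (halfSpace_smul_subset.2 ?_))
    rw [σ.isTree.halfSpace_symm, σ.isTree.halfSpace_symm]
    exact Set.compl_subset_compl.2 hdc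
  have hrd : AlmostSubset (standardSet v (r • d.symm)) (standardSet v d) :=
    h.symm_standardSet.1
  exact ⟨c, ⟨(almostSubset_of_subset (standardSet_subset hlt.1)).trans_standardSet
    (hcr.trans_standardSet hrd), hsub⟩, rfl⟩

/-- If `r` exchanges the class of a standard set with that of its complement, then `r` fixes a
vertex, and an equivalent directed edge ends there. -/
theorem exists_almostEq_fixed_snd {d : σ.T.Dart} {r : G}
    (h : AlmostEq (standardSet v (r • d)) (standardSet v d.symm)) :
    ∃ c : σ.T.Dart, AlmostEq (standardSet v c) (standardSet v d) ∧ r • c.snd = c.snd := by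
  have hr := smul_smul_eq_of_almostEq_symm h
  obtain ⟨p, hp⟩ := σ.isTree.exists_fixed_of_sq_fixed (σ.smulIso r)
    (fun a b hab => σ.no_inversion r a b hab) (y := d.snd)
    (congrArg (fun c : σ.T.Dart => c.snd) hr)
  rw [smulIso_apply] at hp
  by_cases hpd : p ∈ σ.T.halfSpace d
  · have hpd' : p ∉ σ.T.halfSpace d.symm := by
      rwa [σ.isTree.halfSpace_symm, Set.notMem_compl_iff]
    obtain ⟨c, hc, hcp⟩ := exists_almostEq_of_fixed_notMem hp hpd' h.symm_standardSet
    refine ⟨r • c, (hc.smul_standardSet r).trans_standardSet h.symm_standardSet, ?_⟩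
    simp [hcp, hp]
  · obtain ⟨c, hc, hcp⟩ := exists_almostEq_of_fixed_notMem hp hpd h
    exact ⟨c, hc, by rw [hcp, hp]⟩

/-! ### The isomorphism of trees -/

/-- Base edges `e` and `f` of two splittings that are matched so well that `g e ↦ g f` induces an
isomorphism of trees: their standard sets are equivalent, and if elements exchanging the class of
these sets with the class of the complements exist, then one of them fixes the terminal vertices
of both `e` and `f`. The second condition selects the right edges among those with equivalent
standard sets. -/
structure Matched (v : σ.V) (v' : τ.V) (e : σ.T.Dart) (f : τ.T.Dart) : Prop where
  almostEq : AlmostEq (standardSet v e) (standardSet v' f)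
  flip : ∀ g : G, AlmostEq (standardSet v (g • e)) (standardSet v e.symm) →
    ∃ r : G, AlmostEq (standardSet v (r • e)) (standardSet v e.symm) ∧
      r • e.snd = e.snd ∧ r • f.snd = f.snd

/-- Corresponding directed edges: `g e` with `g f`, and `g ē` with `g f̄`. -/
def Corresponds (e : σ.T.Dart) (f : τ.T.Dart) (d : σ.T.Dart) (d' : τ.T.Dart) : Prop :=
  ∃ g : G, (d = g • e ∧ d' = g • f) ∨ (d = g • e.symm ∧ d' = g • f.symm)

/-- Corresponding vertices: `g x` with `g u` and `g y` with `g w`, for `e = (x, y)` and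
`f = (u, w)`. -/
def CorrespondsVert (e : σ.T.Dart) (f : τ.T.Dart) (p : σ.V) (q : τ.V) : Prop :=
  ∃ g : G, (p = g • e.fst ∧ q = g • f.fst) ∨ (p = g • e.snd ∧ q = g • f.snd)

theorem Corresponds.swap {e d : σ.T.Dart} {f d' : τ.T.Dart} (h : Corresponds e f d d') :
    Corresponds f e d' d := by
  obtain ⟨g, h | h⟩ := h
  exacts [⟨g, Or.inl h.symm⟩, ⟨g, Or.inr h.symm⟩]

theorem CorrespondsVert.swap {e : σ.T.Dart} {f : τ.T.Dart} {p : σ.V} {q : τ.V}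
    (h : CorrespondsVert e f p q) : CorrespondsVert f e q p := by
  obtain ⟨g, h | h⟩ := h
  exacts [⟨g, Or.inl h.symm⟩, ⟨g, Or.inr h.symm⟩]

theorem exists_corresponds (e : σ.T.Dart) (f : τ.T.Dart) (d : σ.T.Dart) :
    ∃ d', Corresponds e f d d' := by
  obtain ⟨g, hg | hg⟩ := exists_smul_dart_eq e d
  · exact ⟨g • f, g, Or.inl ⟨hg.symm, rfl⟩⟩
  · refine ⟨g • f.symm, g, Or.inr ⟨?_, rfl⟩⟩
    rw [← smul_symm, hg, SimpleGraph.Dart.symm_symm]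

theorem exists_correspondsVert (e : σ.T.Dart) (f : τ.T.Dart) (p : σ.V) :
    ∃ q, CorrespondsVert e f p q := by
  obtain ⟨g, hg | hg⟩ := exists_smul_eq_fst_or_snd p e
  · exact ⟨g⁻¹ • f.fst, g⁻¹, Or.inl ⟨by rw [← hg, inv_smul_smul], rfl⟩⟩
  · exact ⟨g⁻¹ • f.snd, g⁻¹, Or.inr ⟨by rw [← hg, inv_smul_smul], rfl⟩⟩

namespace Matched

variable {e : σ.T.Dart} {f : τ.T.Dart}

theorem swap (h : Matched v v' e f) : Matched v' v f e := by
  refine ⟨h.almostEq.symm, fun g hg => ?_⟩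
  obtain ⟨r, hr, hre, hrf⟩ := h.flip g <| (h.almostEq.smul_standardSet g).trans_standardSet
    (hg.trans_standardSet h.almostEq.symm.symm_standardSet)
  exact ⟨r, (h.almostEq.symm.smul_standardSet r).trans_standardSet
    (hr.trans_standardSet h.almostEq.symm_standardSet), hrf, hre⟩

theorem ssubset_smul_of_fixed_snd {r : G}
    (hr : AlmostEq (standardSet v (r • e)) (standardSet v e.symm)) (hre : r • e.snd = e.snd) :
    σ.T.halfSpace e ⊂ σ.T.halfSpace (r • e.symm) := by
  refine σ.isTree.halfSpace_ssubset_of_adjacent hre.symm fun hx => ?_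
  have : r • e = e := dart_ext hx hre
  rw [this] at hr
  exact not_almostEq_symm e hr

theorem ssubset_smul_symm_of_almostEq (h : Matched v v' e f) {g : G}
    (hg : AlmostEq (standardSet v (g • e)) (standardSet v e.symm))
    (hlt : σ.T.halfSpace e ⊂ σ.T.halfSpace (g • e.symm)) :
    τ.T.halfSpace f ⊂ τ.T.halfSpace (g • f.symm) := by
  obtain ⟨r, hr, hre, hrf⟩ := h.flip g hg
  have hrf' : AlmostEq (standardSet v' (r • f)) (standardSet v' f.symm) :=
    (h.almostEq.symm.smul_standardSet r).trans_standardSet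
      (hr.trans_standardSet h.almostEq.symm_standardSet)
  refine (ssubset_smul_of_fixed_snd hrf' hrf).trans_subset ?_
  -- `r ē` is the immediate successor of `e`, so `g ē` lies beyond it
  have hrg : AlmostEq (standardSet v (r • e.symm)) (standardSet v (g • e.symm)) :=
    hr.symm_standardSet.trans_standardSet hg.symm_standardSet.symm
  have hle : σ.T.halfSpace (r • e.symm) ⊆ σ.T.halfSpace (g • e.symm) := by
    rcases hrg.comparable with h' | h' | h'
    · rw [h']
    · exact h'.1
    · exact absurd h' (σ.isTree.not_between_of_adjacent hre.symm hlt)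
  have hgr : ∀ c : σ.T.Dart, (g * r⁻¹) • r • c = g • c := by
    intro c
    rw [mul_smul, inv_smul_smul]
  have := (h.almostEq.symm_standardSet.smul_standardSet r).halfSpace_subset_smul
    (g := g * r⁻¹) (by rw [hgr]; exact hrg.symm) (by rwa [hgr])
  rwa [mul_smul, inv_smul_smul] at this

theorem ssubset_smul (h : Matched v v' e f) {g : G}
    (hlt : σ.T.halfSpace e ⊂ σ.T.halfSpace (g • e)) :
    τ.T.halfSpace f ⊂ τ.T.halfSpace (g • f) := by
  rcases halfSpace_ssubset_or_almostEq h.almostEq (h.almostEq.smul_standardSet g) hlt with h' | h'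
  · exact h'
  · exact h.almostEq.halfSpace_ssubset_smul h'.symm hlt

theorem ssubset_smul_symm (h : Matched v v' e f) {g : G}
    (hlt : σ.T.halfSpace e ⊂ σ.T.halfSpace (g • e.symm)) :
    τ.T.halfSpace f ⊂ τ.T.halfSpace (g • f.symm) := by
  rcases halfSpace_ssubset_or_almostEq h.almostEq
    (h.almostEq.symm_standardSet.smul_standardSet g) hlt with h' | h'
  · exact h'
  · have hg := h'.symm.symm_standardSet
    rw [smul_symm, SimpleGraph.Dart.symm_symm] at hg
    exact h.ssubset_smul_symm_of_almostEq hg hlt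

theorem symm_ssubset_smul (h : Matched v v' e f) {g : G}
    (hlt : σ.T.halfSpace e.symm ⊂ σ.T.halfSpace (g • e)) :
    τ.T.halfSpace f.symm ⊂ τ.T.halfSpace (g • f) := by
  rcases halfSpace_ssubset_or_almostEq h.almostEq.symm_standardSet
    (h.almostEq.smul_standardSet g) hlt with h' | h'
  · exact h'
  · have hB : AlmostEq (standardSet v' f.symm) (standardSet v' (g • f)) :=
      h.almostEq.symm.symm_standardSet.trans_standardSet
        (h'.trans_standardSet (h.almostEq.smul_standardSet g))
    rcases hB.comparable with h₁ | h₁ | h₁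
    · exact absurd h₁.symm (smul_ne_symm g f)
    · exact h₁
    · have h₂ : τ.T.halfSpace f ⊂ τ.T.halfSpace (g • f.symm) := by
        rwa [← smul_symm, ← halfSpace_symm_ssubset, SimpleGraph.Dart.symm_symm]
      have h₃ := h.swap.ssubset_smul_symm h₂
      rw [← smul_symm, ← halfSpace_symm_ssubset, SimpleGraph.Dart.symm_symm] at h₃
      exact absurd h₃ hlt.asymm

theorem halfSpace_ssubset (h : Matched v v' e f) {d₁ d₂ : σ.T.Dart} {d₁' d₂' : τ.T.Dart}
    (h₁ : Corresponds e f d₁ d₁') (h₂ : Corresponds e f d₂ d₂')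
    (hlt : σ.T.halfSpace d₁ ⊂ σ.T.halfSpace d₂) : τ.T.halfSpace d₁' ⊂ τ.T.halfSpace d₂' := by
  obtain ⟨g, ⟨rfl, rfl⟩ | ⟨rfl, rfl⟩⟩ := h₁ <;> obtain ⟨k, ⟨rfl, rfl⟩ | ⟨rfl, rfl⟩⟩ := h₂
  · rw [← halfSpace_smul_ssubset (g := g⁻¹), inv_smul_smul, ← mul_smul] at hlt ⊢
    exact h.ssubset_smul hlt
  · rw [← halfSpace_smul_ssubset (g := g⁻¹), inv_smul_smul, ← mul_smul] at hlt ⊢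
    exact h.ssubset_smul_symm hlt
  · rw [← halfSpace_smul_ssubset (g := g⁻¹), inv_smul_smul, ← mul_smul] at hlt ⊢
    exact h.symm_ssubset_smul hlt
  · rw [← smul_symm, ← smul_symm, halfSpace_symm_ssubset] at hlt ⊢
    rw [← halfSpace_smul_ssubset (g := k⁻¹), inv_smul_smul, ← mul_smul] at hlt ⊢
    exact h.ssubset_smul hlt

theorem snd_eq_fst (h : Matched v v' e f) {d₁ d₂ : σ.T.Dart} {d₁' d₂' : τ.T.Dart}
    (h₁ : Corresponds e f d₁ d₁') (h₂ : Corresponds e f d₂ d₂')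
    (hadj : d₁.snd = d₂.fst) (hne : d₂.snd ≠ d₁.fst) : d₁'.snd = d₂'.fst := by
  refine τ.isTree.adjacent_of_not_between
    (h.halfSpace_ssubset h₁ h₂ (σ.isTree.halfSpace_ssubset_of_adjacent hadj hne)) ?_
  intro c' hc₁ hc₂
  obtain ⟨c, hc⟩ := exists_corresponds f e c'
  exact σ.isTree.not_between_of_adjacent hadj (h.swap.halfSpace_ssubset h₁.swap hc hc₁)
    (h.swap.halfSpace_ssubset hc h₂.swap hc₂)

theorem smul_fst_eq_fst (h : Matched v v' e f) {g : G} (hg : g • e.fst = e.fst) :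
    g • f.fst = f.fst := by
  by_cases he : g • e.snd = e.snd
  · exact congrArg (fun c : τ.T.Dart => c.fst)
      (h.almostEq.smul_eq (dart_ext hg he : g • e = e))
  · exact (h.snd_eq_fst (d₁ := e.symm) (d₂ := g • e) (d₁' := f.symm) (d₂' := g • f)
      ⟨1, Or.inr (by simp)⟩ ⟨g, Or.inl ⟨rfl, rfl⟩⟩ hg.symm he).symm

theorem smul_snd_eq_snd (h : Matched v v' e f) {g : G} (hg : g • e.snd = e.snd) :
    g • f.snd = f.snd := by
  by_cases he : g • e.fst = e.fst
  · exact congrArg (fun c : τ.T.Dart => c.snd)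
      (h.almostEq.smul_eq (dart_ext he hg : g • e = e))
  · exact (h.snd_eq_fst (d₁ := e) (d₂ := g • e.symm) (d₁' := f) (d₂' := g • f.symm)
      ⟨1, Or.inl (by simp)⟩ ⟨g, Or.inr ⟨rfl, rfl⟩⟩ hg.symm he).symm

theorem smul_fst_eq_snd (h : Matched v v' e f) {g : G} (hg : g • e.fst = e.snd) :
    g • f.fst = f.snd :=
  (h.snd_eq_fst (d₁ := e) (d₂ := g • e) (d₁' := f) (d₂' := g • f)
    ⟨1, Or.inl (by simp)⟩ ⟨g, Or.inl ⟨rfl, rfl⟩⟩ hg.symm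
    fun hs => σ.no_inversion g _ _ e.adj ⟨hg, hs⟩).symm

theorem correspondsVert_unique (h : Matched v v' e f) {p : σ.V} {q q' : τ.V}
    (hq : CorrespondsVert e f p q) (hq' : CorrespondsVert e f p q') : q = q' := by
  obtain ⟨g, ⟨rfl, rfl⟩ | ⟨rfl, rfl⟩⟩ := hq <;> obtain ⟨k, ⟨hk, rfl⟩ | ⟨hk, rfl⟩⟩ := hq'
  · rw [← inv_smul_eq_iff, ← mul_smul] at hk ⊢
    exact h.smul_fst_eq_fst hk
  · rw [← inv_smul_eq_iff, ← mul_smul] at hk ⊢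
    exact h.smul_fst_eq_snd hk
  · rw [eq_comm, ← inv_smul_eq_iff, ← mul_smul] at hk ⊢
    exact h.smul_fst_eq_snd hk
  · rw [← inv_smul_eq_iff, ← mul_smul] at hk ⊢
    exact h.smul_snd_eq_snd hk

theorem adj (h : Matched v v' e f) {p₁ p₂ : σ.V} {q₁ q₂ : τ.V}
    (h₁ : CorrespondsVert e f p₁ q₁) (h₂ : CorrespondsVert e f p₂ q₂) (hadj : σ.T.Adj p₁ p₂) :
    τ.T.Adj q₁ q₂ := by
  obtain ⟨d', hd'⟩ := exists_corresponds e f (⟨(p₁, p₂), hadj⟩ : σ.T.Dart)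
  obtain ⟨g, ⟨hd, rfl⟩ | ⟨hd, rfl⟩⟩ := hd'
  · have e₁ : p₁ = g • e.fst := congrArg (fun c : σ.T.Dart => c.fst) hd
    have e₂ : p₂ = g • e.snd := congrArg (fun c : σ.T.Dart => c.snd) hd
    rw [h.correspondsVert_unique h₁ ⟨g, Or.inl ⟨e₁, rfl⟩⟩,
      h.correspondsVert_unique h₂ ⟨g, Or.inr ⟨e₂, rfl⟩⟩]
    exact τ.smul_adj g _ _ f.adj
  · have e₁ : p₁ = g • e.snd := congrArg (fun c : σ.T.Dart => c.fst) hd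
    have e₂ : p₂ = g • e.fst := congrArg (fun c : σ.T.Dart => c.snd) hd
    rw [h.correspondsVert_unique h₁ ⟨g, Or.inr ⟨e₁, rfl⟩⟩,
      h.correspondsVert_unique h₂ ⟨g, Or.inl ⟨e₂, rfl⟩⟩]
    exact τ.smul_adj g _ _ f.adj.symm

theorem isomorphic (h : Matched v v' e f) : σ.Isomorphic τ := by
  choose φ hφ using exists_correspondsVert e f
  choose ψ hψ using exists_correspondsVert f e
  refine ⟨⟨⟨φ, ψ, fun p => ?_, fun q => ?_⟩, fun {p₁ p₂} => ⟨fun hq => ?_, fun hp => ?_⟩⟩,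
    fun g p => ?_⟩
  · exact h.swap.correspondsVert_unique (hψ _) (hφ p).swap
  · exact h.correspondsVert_unique (hφ _) (hψ q).swap
  · exact h.swap.adj (hφ p₁).swap (hφ p₂).swap hq
  · exact h.adj (hφ p₁) (hφ p₂) hp
  · refine h.correspondsVert_unique (hφ (g • p)) ?_
    obtain ⟨k, ⟨h₁, h₂⟩ | ⟨h₁, h₂⟩⟩ := hφ p
    · exact ⟨g * k, Or.inl ⟨by rw [mul_smul, ← h₁], by rw [mul_smul, ← h₂]; rfl⟩⟩
    · exact ⟨g * k, Or.inr ⟨by rw [mul_smul, ← h₁], by rw [mul_smul, ← h₂]; rfl⟩⟩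

end Matched

/-- Splittings with equivalent standard almost invariant sets are isomorphic. -/
theorem isomorphic_of_almostEq {e : σ.T.Dart} {f : τ.T.Dart}
    (h : AlmostEq (standardSet v e) (standardSet v' f)) : σ.Isomorphic τ := by
  by_cases hr : ∃ r : G, AlmostEq (standardSet v (r • e)) (standardSet v e.symm)
  · obtain ⟨r, hr⟩ := hr
    have hr' : AlmostEq (standardSet v' (r • f)) (standardSet v' f.symm) :=
      (h.symm.smul_standardSet r).trans_standardSet (hr.trans_standardSet h.symm_standardSet)
    obtain ⟨c, hc, hrc⟩ := exists_almostEq_fixed_snd hr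
    obtain ⟨c', hc', hrc'⟩ := exists_almostEq_fixed_snd hr'
    refine Matched.isomorphic (v := v) (v' := v') (e := c) (f := c')
      ⟨hc.trans_standardSet (h.trans_standardSet hc'.symm), fun _ _ => ⟨r, ?_, hrc, hrc'⟩⟩
    exact (hc.smul_standardSet r).trans_standardSet
      (hr.trans_standardSet hc.symm.symm_standardSet)
  · exact Matched.isomorphic (v := v) (v' := v') (e := e) (f := f)
      ⟨h, fun g hg => absurd ⟨g, hg⟩ hr⟩

end

end GroupSplitting

/-! ### Corners, good position and the partial order -/

namespace GroupSplitting

variable {G : Type u} [Group G]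

theorem side_not {α : Type*} (A : Set α) (b : Bool) : side A (!b) = (side A b)ᶜ := by
  cases b <;> simp [side]

theorem stabilizer_side (A : Set G) (b : Bool) :
    MulAction.stabilizer G (side A b) = MulAction.stabilizer G A := by
  cases b
  · exact stabilizer_compl G G
  · rfl

theorem IsAlmostInvariant.side {A : Set G} (h : IsAlmostInvariant A) (b : Bool) :
    IsAlmostInvariant (side A b) := by
  cases b
  exacts [h.compl, h]

theorem exists_side_eq_standardSet {σ : GroupSplitting.{u, w} G} (v : σ.V) (d : σ.T.Dart)
    (b : Bool) : ∃ c : σ.T.Dart, side (standardSet v d) b = standardSet v c := by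
  cases b
  exacts [⟨d.symm, compl_standardSet v d⟩, ⟨d, rfl⟩]

theorem IsAlmostInvariant.isFiniteMod_corner_iff {A B : Set G} (hA : IsAlmostInvariant A)
    (hB : IsAlmostInvariant B) (p : Bool × Bool) :
    IsFiniteMod (MulAction.stabilizer G A) (corner A B p) ↔
      IsFiniteMod (MulAction.stabilizer G B) (corner A B p) := by
  have := (hA.side p.1).isFiniteMod_inter_iff (hB.side p.2)
  rwa [stabilizer_side, stabilizer_side] at this

/-- Two distinct small corners are opposite: two adjacent ones make up one of the four sets
`A`, `A*`, `B`, `B*`. -/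
theorem IsAlmostInvariant.eq_not_of_isSmallCorner {A B : Set G} (hA : IsAlmostInvariant A)
    (hB : IsAlmostInvariant B) {p q : Bool × Bool} (hpq : p ≠ q) (hp : IsSmallCorner A B p)
    (hq : IsSmallCorner A B q) : q = (!p.1, !p.2) := by
  obtain ⟨a, b⟩ := p
  obtain ⟨a', b'⟩ := q
  have h₁ : a' ≠ a := by
    rintro rfl
    have hb : b' = !b := by cases b <;> cases b' <;> simp_all
    refine (hA.side a').1 ?_
    rw [stabilizer_side]
    refine (IsFiniteMod.union hp hq).mono le_rfl ?_
    simp only [corner, hb, side_not]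
    rw [Set.inter_union_compl]
  have h₂ : b' ≠ b := by
    rintro rfl
    have ha : a' = !a := by cases a <;> cases a' <;> simp_all
    refine (hB.side b').1 ?_
    rw [stabilizer_side]
    refine (((hA.isFiniteMod_corner_iff hB _).1 hp).union
      ((hA.isFiniteMod_corner_iff hB _).1 hq)).mono le_rfl ?_
    simp only [corner, ha, side_not]
    rw [← Set.union_inter_distrib_right, Set.union_compl_self, Set.univ_inter]
  exact Prod.ext (Bool.eq_not.2 h₁) (Bool.eq_not.2 h₂)

theorem AlmostLE.almostSubset {A B : Set G} (h : AlmostLE A B) : AlmostSubset A B := by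
  rcases h with h | h
  · rw [AlmostSubset, h]
    exact isFiniteMod_empty _
  · exact (h (true, false)).2 rfl

theorem AlmostLE.subset {A B : Set G} (h : AlmostLE A B) (h' : AlmostSubset B A)
    (hA : IsAlmostInvariant A) (hB : IsAlmostInvariant B) : A ⊆ B := by
  rcases h with h | h
  · rwa [← Set.sdiff_eq, Set.sdiff_eq_empty] at h
  · have hsmall : IsSmallCorner A B (false, true) := by
      rw [hB.almostSubset_iff hA, Set.inter_comm] at h'
      exact h'
    simpa using (h _).1 hsmall

theorem AlmostLE.trans {S : Set (Set G)} (hS : ∀ A ∈ S, IsAlmostInvariant A)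
    (hgood : InGoodPosition S) {A B C : Set G} (hA : A ∈ S) (hB : B ∈ S) (hC : C ∈ S)
    (h : AlmostLE A B) (h' : AlmostLE B C) : AlmostLE A C := by
  have hAC : AlmostSubset A C :=
    h.almostSubset.trans h'.almostSubset (hS A hA) (hS B hB) (hS C hC)
  by_cases hempty : A ∩ Cᶜ = ∅
  · exact Or.inl hempty
  refine Or.inr fun p => ⟨fun hp => ?_, fun hp => hp ▸ hAC⟩
  by_contra hne
  have hp' := (hS A hA).eq_not_of_isSmallCorner (hS C hC) (Ne.symm hne) hAC hp
  simp only [Bool.not_true, Bool.not_false] at hp'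
  subst hp'
  rcases hgood A hA C hC _ _ hne hp hAC with h₁ | h₁
  · -- now `C ⊆ A`, so `A`, `B` and `C` are equivalent and the relations are inclusions
    have hCA : C ⊆ A := by
      rw [← Set.sdiff_eq_empty, Set.sdiff_eq, Set.inter_comm]
      exact h₁
    have hCA' := almostSubset_of_subset hCA
    have hAB := h.subset (h'.almostSubset.trans hCA' (hS B hB) (hS C hC) (hS A hA))
      (hS A hA) (hS B hB)
    have hBC := h'.subset (hCA'.trans h.almostSubset (hS C hC) (hS A hA) (hS B hB))
      (hS B hB) (hS C hC)
    refine hempty ?_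
    rw [← Set.sdiff_eq, Set.sdiff_eq_empty]
    exact hAB.trans hBC
  · exact hempty h₁

theorem isPartialOrder_almostLE {S : Set (Set G)} (hS : ∀ A ∈ S, IsAlmostInvariant A)
    (hgood : InGoodPosition S) :
    IsPartialOrder S (fun A B => AlmostLE (A : Set G) (B : Set G)) where
  refl _ := Or.inl (Set.inter_compl_self _)
  trans A B C h h' := AlmostLE.trans hS hgood A.2 B.2 C.2 h h'
  antisymm A B h h' := Subtype.ext <|
    (h.subset h'.almostSubset (hS A A.2) (hS B B.2)).antisymm
      (h'.subset h.almostSubset (hS B B.2) (hS A A.2))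

theorem exists_standardSet_of_mem_translates {J : Type*} {σ : J → GroupSplitting.{u, w} G}
    {X : J → Set G} {v : ∀ j, (σ j).V} {e : ∀ j, (σ j).T.Dart}
    (hX : ∀ j, X j = standardSet (v j) (e j)) {A : Set G} (hA : A ∈ translates X) :
    ∃ (j : J) (d : (σ j).T.Dart), A = standardSet (v j) d := by
  obtain ⟨j, g, rfl | rfl⟩ := hA
  · exact ⟨j, g • e j, by rw [hX, smul_standardSet]⟩
  · exact ⟨j, g • (e j).symm, by rw [hX, compl_standardSet, smul_standardSet]⟩

theorem corner_eq_empty_of_subset {α : Type*} {A B : Set α} {a b : Bool} (h : side A a ⊆ side B b) :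
    corner A B (a, !b) = ∅ := by
  rw [corner, side_not, ← Set.sdiff_eq, Set.sdiff_eq_empty]
  exact h

/-- In one tree equivalent standard sets are nested; in two trees that are not isomorphic no
standard sets are equivalent. -/
theorem inGoodPosition_translates {J : Type*} {σ : J → GroupSplitting.{u, w} G}
    (hσ : ∀ j k : J, j ≠ k → ¬ (σ j).Isomorphic (σ k)) {X : J → Set G} {v : ∀ j, (σ j).V}
    {e : ∀ j, (σ j).T.Dart} (hX : ∀ j, X j = standardSet (v j) (e j)) :
    InGoodPosition (translates X) := by
  intro A hA B hB p q hpq hp hq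
  obtain ⟨j, d, rfl⟩ := exists_standardSet_of_mem_translates hX hA
  obtain ⟨k, c, rfl⟩ := exists_standardSet_of_mem_translates hX hB
  have hd := isAlmostInvariant_standardSet (v j) d
  have hc := isAlmostInvariant_standardSet (v k) c
  have hq' := hd.eq_not_of_isSmallCorner hc hpq hp hq
  obtain ⟨a, b⟩ := p
  subst hq'
  have hp' : AlmostSubset (side (standardSet (v j) d) a) (side (standardSet (v k) c) (!b)) := by
    rw [AlmostSubset, stabilizer_side, side_not, compl_compl]
    exact hp
  have hq' : AlmostSubset (side (standardSet (v k) c) (!b)) (side (standardSet (v j) d) a) := by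
    rw [(hc.side _).almostSubset_iff (hd.side _), stabilizer_side, ← side_not, Set.inter_comm]
    exact hq
  obtain ⟨d', hd'⟩ := exists_side_eq_standardSet (v j) d a
  obtain ⟨c', hc'⟩ := exists_side_eq_standardSet (v k) c (!b)
  rw [hd', hc'] at hp' hq'
  by_cases hjk : j = k
  · subst hjk
    rcases halfSpace_subset_or_subset hp' with h | h
    · left
      have := standardSet_subset (v := v j) h
      rw [← hd', ← hc'] at this
      simpa using corner_eq_empty_of_subset this
    · right
      have := standardSet_subset (v := v j) h
      rw [← hd', ← hc'] at this
      rw [corner, side_not, Set.inter_comm, ← Set.sdiff_eq, Set.sdiff_eq_empty]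
      exact this
  · exact absurd (isomorphic_of_almostEq ⟨hp', hq'⟩) (hσ j k hjk)

end GroupSplitting

theorem corollary5p5 {G : Type*} [Group G] {J : Type*} (σ : J → GroupSplitting G)
    (hσ : ∀ j k : J, j ≠ k → ¬ (σ j).Isomorphic (σ k))
    (X : J → Set G) (hX : ∀ j : J, (σ j).IsStandardSet (X j)) :
    -- smallness does not depend on which of the two stabilizers is used
    (∀ A ∈ GroupSplitting.translates X, ∀ B ∈ GroupSplitting.translates X, ∀ p : Bool × Bool,
      GroupSplitting.IsFiniteMod (MulAction.stabilizer G A) (GroupSplitting.corner A B p) ↔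
        GroupSplitting.IsFiniteMod (MulAction.stabilizer G B) (GroupSplitting.corner A B p)) ∧
    GroupSplitting.InGoodPosition (GroupSplitting.translates X) ∧
    IsPartialOrder (GroupSplitting.translates X)
      (fun A B => GroupSplitting.AlmostLE (A : Set G) (B : Set G)) := by
  choose v e hX using hX
  have hS : ∀ A ∈ GroupSplitting.translates X, GroupSplitting.IsAlmostInvariant A := by
    intro A hA
    obtain ⟨j, d, rfl⟩ := GroupSplitting.exists_standardSet_of_mem_translates hX hA
    exact GroupSplitting.isAlmostInvariant_standardSet (v j) d
  have hgood := GroupSplitting.inGoodPosition_translates hσ hX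
  exact ⟨fun A hA B hB p => (hS A hA).isFiniteMod_corner_iff (hS B hB) p, hgood,
    GroupSplitting.isPartialOrder_almostLE hS hgood⟩
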